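/- Let $M$ be a weakly contractible simplicial set, i.e. such that $M \to \Delta^0$ is a weak equivalence in the Kan–Quillen model structure $s\mathrm{Set}_{\mathrm{KQ}}$ (the model structure cofibrantly generated by $\{\partial\Delta^n \to \Delta^n\}_{n\ge 0}$ and $\{\Lambda^n_i \to \Delta^n\}_{0\le i\le n\ge 1}$). Let $\mathrm{diag}^* : ss\mathrm{Set} = \mathrm{Fun}(\Delta^{op}\times\Delta^{op},\mathrm{Set}) \to s\mathrm{Set}$ be restriction along the diagonal $\mathrm{diag} : \Delta^{op}\to\Delta^{op}\times\Delta^{op}$, let $\mathrm{diag}_!$ be its left adjoint (left Kan extension along $\mathrm{diag}$), and let $\mathrm{const}(M)$ be the bisimplicial set $\mathrm{const}(M)_{j,k} = M_j$, so that $\mathrm{diag}^*(\mathrm{const}(M)) \cong M$. Then the component $$\mathrm{diag}_!(M) \cong \mathrm{diag}_!(\mathrm{diag}^*(\mathrm{const}(M))) \longrightarrow \mathrm{const}(M)$$ of the counit of the adjunction $\mathrm{diag}_! \dashv \mathrm{diag}^*$ is a weak equivalence in the Reedy model structure $s(s\mathrm{Set}_{\mathrm{KQ}})_{\mathrm{Reedy}}$;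 that is, for every $j \ge 0$ the map of simplicial sets $\mathrm{diag}_!(M)_{j,\bullet} \to \mathrm{const}(M)_{j,\bullet}$ (whose target is the discrete simplicial set on $M_j$) is a Kan–Quillen weak equivalence. -/

import Mathlib

open CategoryTheory

universe u

namespace BisimplicialSets

/-- A morphism of simplicial sets is a weak equivalence of the Kan--Quillen model structure, that
is, of the model structure cofibrantly generated by the boundary inclusions
`I = {∂Δ[n] ⟶ Δ[n]}` and the horn inclusions `J = {Λ[n, i] ⟶ Δ[n]}` (`n ≥ 1`).
The acyclic fibrations of this structure are `rlp(I)` and its acyclic cofibrations are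
`llp(rlp(J))`, so that its weak equivalences are the maps that factor as an acyclic cofibration
followed by an acyclic fibration. -/
def kanQuillenW : MorphismProperty SSet.{u} := fun X Y f =>
  ∃ (Z : SSet.{u}) (i : X ⟶ Z) (p : Z ⟶ Y),
    SSet.modelCategoryQuillen.J.{u}.rlp.llp i ∧ SSet.modelCategoryQuillen.I.{u}.rlp p ∧ i ≫ p = f

/-- A simplicial set is acyclic (weakly contractible) if its map to the terminal simplicial set is
a Kan--Quillen weak equivalence. -/
def IsAcyclic (M : SSet.{u}) : Prop :=
  kanQuillenW (Limits.terminal.from M)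

/-- Bisimplicial sets; the first variable is the outer one when a bisimplicial set is viewed as a
simplicial object in simplicial sets. -/
abbrev SSSet : Type (u + 1) := SimplexCategoryᵒᵖ × SimplexCategoryᵒᵖ ⥤ Type u

/-- The diagonal functor `Δᵒᵖ ⥤ Δᵒᵖ × Δᵒᵖ`. -/
abbrev diag : SimplexCategoryᵒᵖ ⥤ SimplexCategoryᵒᵖ × SimplexCategoryᵒᵖ :=
  Functor.diag SimplexCategoryᵒᵖ

/-- Restriction along the diagonal, `X ↦ ([n] ↦ X_{n,n})`. -/
abbrev diagPull : SSSet.{u} ⥤ SSet.{u} :=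
  (Functor.whiskeringLeft _ _ (Type u)).obj diag

/-- Left Kan extension along the diagonal. -/
noncomputable abbrev diagShriek : SSet.{u} ⥤ SSSet.{u} :=
  Functor.lan (H := Type u) diag

/-- The adjunction between left Kan extension and restriction along the diagonal. -/
noncomputable abbrev diagAdjunction : diagShriek.{u} ⊣ diagPull.{u} :=
  Functor.lanAdjunction diag (Type u)

/-- `const M` has `const(M)_{j,k} = M_j`: its `j`-th level is the discrete simplicial set on
the set `M_j`. -/
abbrev const : SSet.{u} ⥤ SSSet.{u} :=
  (Functor.whiskeringLeft _ _ (Type u)).obj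
    (CategoryTheory.Prod.fst SimplexCategoryᵒᵖ SimplexCategoryᵒᵖ)

/-- The canonical identification of `M` with the diagonal of `const M`. -/
def constDiagIso : 𝟭 SSet.{u} ≅ const.{u} ⋙ diagPull.{u} :=
  Iso.refl _

/-- The natural transformation `diag_!(M) ≅ diag_!(diag^*(const M)) ⟶ const M`, whose second map is
the counit of the adjunction. -/
noncomputable def counitToConst (M : SSet.{u}) : diagShriek.obj M ⟶ const.obj M :=
  diagShriek.map (constDiagIso.hom.app M) ≫ diagAdjunction.counit.app (const.obj M)

/-- The `j`-th level `k ↦ X_{j,k}` of a bisimplicial set. -/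
abbrev level (j : SimplexCategoryᵒᵖ) : SSSet.{u} ⥤ SSet.{u} :=
  (Functor.whiskeringLeft _ _ (Type u)).obj (CategoryTheory.Prod.sectR j SimplexCategoryᵒᵖ)

/-- The weak equivalences of the Reedy model structure on simplicial objects in the Kan--Quillen
model category of simplicial sets: the levelwise weak equivalences. -/
def reedyW : MorphismProperty SSSet.{u} := fun _ _ f =>
  ∀ j : SimplexCategoryᵒᵖ, kanQuillenW ((level j).map f)

end BisimplicialSets

/-! An element of `diag_!(M)_{j,k}` is a class of triples: a simplex `x : M_n`, a map `α : [j] ⟶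
[n]` and a map `β : [k] ⟶ [n]`. The counit sends it to `α^* x`, so for fixed `j` it forgets `β`, a
simplex of the contractible `Δ[n]`. The contraction must respect the gluing along all monotone maps,
so it uses only the vertex `v = α 0` and `min`, which monotone maps preserve: `b ≥ min v b ≤ v` is a
natural zigzag from the identity to the constant map at `v`. These homotopies descend to
`diag_!(M)_{j,•}` and fix the section `levelSection` of the counit, which is therefore anodyne
(`anodyneExtensions_of_zigzag`). A map with an anodyne section is a weak equivalence
(`kanQuillenW_of_anodyne_section`): factor it as anodyne map followed by fibration, and apply
`rlp_I_of_anodyne_section` to the fibration. -/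

namespace BisimplicialSets

open MonoidalCategory CartesianMonoidalCategory Simplicial Opposite HomotopicalAlgebra SSet
open SSet.modelCategoryQuillen Limits

/-! ### Homotopy lifting for Kan fibrations -/

section HomotopyLifting

/-- Lifting a square against a pushout-product, with the pushout unfolded. -/
lemma exists_lift_of_pushoutObjObj {A B K L X Y : SSet.{u}} {i : A ⟶ B} {j : K ⟶ L} {p : X ⟶ Y}
    (h : ∀ sq : (curriedTensor SSet.{u}).PushoutObjObj i j, HasLiftingProperty sq.ι p)
    (f : A ⊗ L ⟶ X) (g : B ⊗ K ⟶ X) (w : B ⊗ L ⟶ Y)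
    (hfg : i ▷ K ≫ g = A ◁ j ≫ f) (hf : f ≫ p = i ▷ L ≫ w) (hg : g ≫ p = B ◁ j ≫ w) :
    ∃ l : B ⊗ L ⟶ X, i ▷ L ≫ l = f ∧ B ◁ j ≫ l = g ∧ l ≫ p = w := by
  let sq := Functor.PushoutObjObj.ofHasPushout (curriedTensor SSet.{u}) i j
  have := h sq
  have hinl : sq.inl ≫ sq.ι = B ◁ j := sq.inl_ι
  have hinr : sq.inr ≫ sq.ι = i ▷ L := sq.inr_ι
  let t : sq.pt ⟶ X := sq.isPushout.desc g f hfg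
  have ht₁ : sq.inl ≫ t = g := sq.isPushout.inl_desc _ _ _
  have ht₂ : sq.inr ≫ t = f := sq.isPushout.inr_desc _ _ _
  have comm : CommSq t sq.ι p w := ⟨by
    apply sq.hom_ext
    · rw [reassoc_of% ht₁, reassoc_of% hinl, hg]
    · rw [reassoc_of% ht₂, reassoc_of% hinr, hf]⟩
  refine ⟨comm.lift, ?_, ?_, comm.fac_right⟩
  · rw [← hinr, Category.assoc, comm.fac_left, ht₂]
  · rw [← hinl, Category.assoc, comm.fac_left, ht₁]

/-- The inclusion of an end of the cylinder. -/
noncomputable def cylinderEnd (ε : Fin 2) (X : SSet.{u}) : X ⟶ X ⊗ Δ[1] :=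
  lift (𝟙 X) (SSet.const (stdSimplex.obj₀Equiv.symm ε))

lemma cylinderEnd_comp_assoc (ε : Fin 2) {X Y Z : SSet.{u}} (f : X ⟶ Y) (g : Y ⊗ Δ[1] ⟶ Z) :
    cylinderEnd ε X ≫ f ▷ Δ[1] ≫ g = f ≫ cylinderEnd ε Y ≫ g := rfl

lemma cylinderEnd_fst_assoc (ε : Fin 2) {X Y : SSet.{u}} (f : X ⟶ Y) :
    cylinderEnd ε X ≫ fst X Δ[1] ≫ f = f := rfl

lemma stdSimplex_ext {n : ℕ} {m : SimplexCategoryᵒᵖ} {s t : (Δ[n] : SSet.{u}).obj m}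
    (h : ∀ k, stdSimplex.asOrderHom s k = stdSimplex.asOrderHom t k) : s = t :=
  SSet.stdSimplex.ext (d := m.unop.len) _ _ h

lemma horn_one_apply (ε : Fin 2) {m : SimplexCategoryᵒᵖ} (t : (Λ[1, ε] : SSet.{u}).obj m)
    (k : Fin (m.unop.len + 1)) : stdSimplex.asOrderHom t.1 k = ε := by
  obtain ⟨i, hi, hi'⟩ : ∃ i, i ≠ ε ∧ ∀ x, stdSimplex.asOrderHom t.1 x ≠ i := by
    have := t.2
    rw [mem_horn_iff] at this
    simpa only [ne_eq, Set.eq_univ_iff_forall, not_forall, Set.mem_union, Set.mem_range, not_or,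
      not_exists, Set.mem_singleton_iff, and_comm] using this
  grind

lemma whiskerLeft_horn_one_ι (ε : Fin 2) (X : SSet.{u}) :
    X ◁ Λ[1, ε].ι = fst X _ ≫ cylinderEnd ε X := by
  ext m ⟨x, t⟩
  · rfl
  · exact stdSimplex_ext (horn_one_apply ε t)

/-- Covering homotopy extension for Kan fibrations. -/
lemma exists_homotopy_lift (ε : Fin 2) {A B X Y : SSet.{u}} (i : A ⟶ B) [Mono i] (p : X ⟶ Y)
    [Fibration p] (f : A ⊗ Δ[1] ⟶ X) (g : B ⟶ X) (w : B ⊗ Δ[1] ⟶ Y)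
    (hfg : i ≫ g = cylinderEnd ε A ≫ f) (hf : f ≫ p = i ▷ Δ[1] ≫ w)
    (hg : g ≫ p = cylinderEnd ε B ≫ w) :
    ∃ l : B ⊗ Δ[1] ⟶ X, i ▷ Δ[1] ≫ l = f ∧ cylinderEnd ε B ≫ l = g ∧ l ≫ p = w := by
  obtain ⟨l, h₁, h₂, h₃⟩ := exists_lift_of_pushoutObjObj (i := i) (j := Λ[1, ε].ι) (p := p)
    (fun sq ↦ anodyneExtensions_pushoutObjObjι sq (.horn_ι ε) _
      ((HomotopicalAlgebra.fibration_iff p).1 inferInstance)) f (fst _ _ ≫ g) w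
    (by rw [whiskerLeft_horn_one_ι, Category.assoc, ← hfg]; rfl) hf
    (by rw [whiskerLeft_horn_one_ι, Category.assoc, Category.assoc, hg])
  refine ⟨l, h₁, ?_, h₃⟩
  rw [whiskerLeft_horn_one_ι, Category.assoc] at h₂
  have hε : (stdSimplex.obj₀Equiv.symm ε : (Δ[1] : SSet.{u}) _⦋0⦌) ∈ (horn.{u} 1 ε).obj _ := by
    rw [mem_horn_iff_notMem_range]
    refine ⟨1 - ε, by fin_cases ε <;> simp, ?_⟩
    rintro ⟨x, hx⟩
    change ε = 1 - ε at hx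
    fin_cases ε <;> simp at hx
  -- `Λ[1, ε]` is the single vertex `ε`; `c` is a section of the projection, used to cancel it in
  -- `h₂`.
  let c : B ⟶ B ⊗ (Λ[1, ε] : SSet.{u}) :=
    lift (𝟙 B) (SSet.const ⟨stdSimplex.obj₀Equiv.symm ε, hε⟩)
  have hc : c ≫ fst _ _ = 𝟙 B := rfl
  simpa [reassoc_of% hc] using c ≫= h₂

lemma boundary_one_apply {m : SimplexCategoryᵒᵖ} (t : (∂Δ[1] : SSet.{u}).obj m)
    (k l : Fin (m.unop.len + 1)) :
    stdSimplex.asOrderHom t.1 k = stdSimplex.asOrderHom t.1 l := by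
  obtain ⟨i, hi⟩ : ∃ i, ∀ x, stdSimplex.asOrderHom t.1 x ≠ i := by
    have h := t.2
    change ¬ Function.Surjective _ at h
    simpa only [Function.Surjective, not_forall, not_exists] using h
  grind

/-- A Kan fibration with an anodyne section is an acyclic fibration. -/
lemma rlp_I_of_anodyne_section {Z D : SSet.{u}} (p : Z ⟶ D) [Fibration p] (σ : D ⟶ Z)
    (hσ : anodyneExtensions σ) (hp : σ ≫ p = 𝟙 D) : I.rlp p := by
  -- `p ≫ σ` at the end `0` and the identity at the end `1`. Simplices of `∂Δ[1]` are constant, so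
  -- testing the vertex `0` decides the end.
  let g : Z ⊗ (∂Δ[1] : SSet.{u}) ⟶ Z :=
    { app m := ↾fun x ↦ if stdSimplex.asOrderHom x.2.1 0 = 0 then (p ≫ σ).app m x.1 else x.1
      naturality m m' φ := by
        ext ⟨z, t⟩
        have ht : stdSimplex.asOrderHom ((∂Δ[1] : SSet.{u}).map φ t).1 0 =
          stdSimplex.asOrderHom t.1 0 := boundary_one_apply t (φ.unop.toOrderHom 0) 0
        change (if stdSimplex.asOrderHom ((∂Δ[1] : SSet.{u}).map φ t).1 0 = 0 then
          (p ≫ σ).app m' (Z.map φ z) else Z.map φ z) =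
          Z.map φ (if stdSimplex.asOrderHom t.1 0 = 0 then (p ≫ σ).app m z else z)
        rw [ht]
        split_ifs
        · exact NatTrans.naturality_apply (p ≫ σ) φ z
        · rfl }
  have hg (m) (z : Z.obj m) (t : (∂Δ[1] : SSet.{u}).obj m) : g.app m ⟨z, t⟩ =
      if stdSimplex.asOrderHom t.1 0 = 0 then (p ≫ σ).app m z else z := rfl
  have hσp (m) (d : D.obj m) : p.app m (σ.app m d) = d :=
    ConcreteCategory.congr_hom (NatTrans.congr_app hp m) d
  -- `H` is a homotopy over `D` from `p ≫ σ` to the identity; it exists because `σ` is anodyne.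
  obtain ⟨H, -, h₂, h₃⟩ := exists_lift_of_pushoutObjObj (i := σ) (j := ∂Δ[1].ι) (p := p)
    (fun sq ↦ anodyneExtensions_pushoutObjObjι' sq hσ _
      ((HomotopicalAlgebra.fibration_iff p).1 inferInstance))
    (fst _ _ ≫ σ) g (fst _ _ ≫ p)
    (by
      ext m ⟨d, t⟩
      change g.app m ⟨σ.app m d, t⟩ = σ.app m d
      rw [hg]
      split_ifs
      · exact congr_arg _ (hσp m d)
      · rfl)
    (by rw [Category.assoc, hp]; rw [whiskerRight_fst_assoc, hp])
    (by
      ext m ⟨d, t⟩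
      change p.app m (g.app m ⟨d, t⟩) = p.app m d
      rw [hg]
      split_ifs
      · exact hσp m _
      · rfl)
  have hH (ε : Fin 2) (m) (z : Z.obj m) : (cylinderEnd ε Z ≫ H).app m z =
      if ε = 0 then (p ≫ σ).app m z else z := by
    let t : (∂Δ[1] : SSet.{u}).obj m :=
      ⟨stdSimplex.const 1 ε m, fun h ↦ by
        obtain ⟨x, hx⟩ := h (1 - ε)
        change ε = 1 - ε at hx
        fin_cases ε <;> simp at hx⟩
    exact (ConcreteCategory.congr_hom (NatTrans.congr_app h₂ m) ⟨z, t⟩).trans (hg m z t)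
  have H₀ : cylinderEnd 0 Z ≫ H = p ≫ σ := by
    ext m z
    simpa using hH 0 m z
  have H₁ : cylinderEnd 1 Z ≫ H = 𝟙 Z := by
    ext m z
    simpa using hH 1 m z
  rintro _ _ _ ⟨n⟩
  refine ⟨fun {a b} sq ↦ ?_⟩
  -- `b ≫ σ` lifts `b` but has the wrong boundary. `H` moves that boundary to `a`, and `G` extends
  -- this motion over `b`; its end `1` is the filler.
  obtain ⟨G, g₁, g₂, g₃⟩ := exists_homotopy_lift 0 ∂Δ[n].ι p (a ▷ _ ≫ H) (b ≫ σ) (fst _ _ ≫ b)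
    (by rw [cylinderEnd_comp_assoc, H₀, reassoc_of% sq.w])
    (by rw [Category.assoc, h₃]; simp [sq.w])
    (by rw [Category.assoc, hp, Category.comp_id, cylinderEnd_fst_assoc])
  refine ⟨⟨⟨cylinderEnd 1 _ ≫ G, ?_, ?_⟩⟩⟩
  · rw [← cylinderEnd_comp_assoc, g₁, cylinderEnd_comp_assoc, H₁, Category.comp_id]
  · rw [Category.assoc, g₃, cylinderEnd_fst_assoc]

end HomotopyLifting

/-! ### Generators and relations for `diag_!(M)` -/

section Generators

variable {M : SSet.{u}} {j k n : SimplexCategoryᵒᵖ}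

/-- The element of `diag_!(M)_{j,k}` given by `x : M_n`, `[j] ⟶ [n]` and `[k] ⟶ [n]`. -/
noncomputable def gen (x : M.obj n) (α : n ⟶ j) (β : n ⟶ k) : (diagShriek.obj M).obj (j, k) :=
  (diagShriek.obj M).map (Prod.mkHom α β) ((diag.lanUnit.app M).app n x)

lemma map_gen (x : M.obj n) (α : n ⟶ j) (β : n ⟶ k) {j' k' : SimplexCategoryᵒᵖ}
    (f : (j, k) ⟶ (j', k')) :
    (diagShriek.obj M).map f (gen x α β) = gen x (α ≫ f.1) (β ≫ f.2) := by
  simp only [gen, ← Functor.map_comp_apply]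
  rfl

lemma map_right_gen (x : M.obj n) (α : n ⟶ j) (β : n ⟶ k) {k' : SimplexCategoryᵒᵖ} (ψ : k ⟶ k') :
    (diagShriek.obj M).map (Prod.mkHom (𝟙 j) ψ) (gen x α β) = gen x α (β ≫ ψ) :=
  (map_gen x α β _).trans (congr_arg (gen x · (β ≫ ψ)) (Category.comp_id α))

/-- The gluing relation of the colimit, from naturality of the unit. -/
lemma gen_map {n' : SimplexCategoryᵒᵖ} (x : M.obj n) (θ : n ⟶ n') (α : n' ⟶ j) (β : n' ⟶ k) :
    gen (M.map θ x) α β = gen x (θ ≫ α) (θ ≫ β) := by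
  have h : (diag.lanUnit.app M).app n' (M.map θ x) =
      (diagShriek.obj M).map (Prod.mkHom θ θ) ((diag.lanUnit.app M).app n x) :=
    NatTrans.naturality_apply (diag.lanUnit.app M) θ x
  rw [gen, h]
  exact map_gen x θ θ (Prod.mkHom α β)

lemma lanUnit_app_app_counitToConst (M : SSet.{u}) (n : SimplexCategoryᵒᵖ) :
    (diag.lanUnit.app M).app n ≫ (counitToConst M).app (n, n) = 𝟙 (M.obj n) := by
  have h : counitToConst M = (diag.lanAdjunction (Type u)).counit.app (const.obj M) := by
    exact (congr_arg (· ≫ _) (CategoryTheory.Functor.map_id diagShriek M)).trans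
      (Category.id_comp _)
  rw [h]
  exact diag.lanUnit_app_app_lanAdjunction_counit_app_app (const.obj M) n

lemma counitToConst_gen (x : M.obj n) (α : n ⟶ j) (β : n ⟶ k) :
    (counitToConst M).app (j, k) (gen x α β) = M.map α x := by
  have h : (counitToConst M).app (n, n) ((diag.lanUnit.app M).app n x) = x := by
    have := ConcreteCategory.congr_hom (lanUnit_app_app_counitToConst M n) x
    exact this
  refine (NatTrans.naturality_apply (counitToConst M) (Prod.mkHom α β)
    ((diag.lanUnit.app M).app n x)).trans ?_
  exact congr_arg (M.map α) h

lemma exists_gen (z : (diagShriek.obj M).obj (j, k)) :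
    ∃ (n : SimplexCategoryᵒᵖ) (x : M.obj n) (α : n ⟶ j) (β : n ⟶ k), z = gen x α β := by
  obtain ⟨f, x, h⟩ := Types.jointly_surjective_of_isColimit
    (diag.isPointwiseLeftKanExtensionLeftKanExtensionUnit M (j, k)) z
  exact ⟨f.left, x, f.hom.1, f.hom.2, h.symm⟩

/-- Functions out of `diag_!(M)_{j,k}`. -/
noncomputable def genDesc {Z : Type u}
    (b : ∀ n : SimplexCategoryᵒᵖ, M.obj n → (n ⟶ j) → (n ⟶ k) → Z)
    (hb : ∀ (n n' : SimplexCategoryᵒᵖ) (θ : n ⟶ n') (x : M.obj n) (α : n' ⟶ j) (β : n' ⟶ k),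
      b n' (M.map θ x) α β = b n x (θ ≫ α) (θ ≫ β)) :
    (diagShriek.obj M).obj (j, k) ⟶ Z :=
  (diag.isPointwiseLeftKanExtensionLeftKanExtensionUnit M (j, k)).desc
    { pt := Z
      ι :=
        { app f := ↾fun x ↦ b f.left x f.hom.1 f.hom.2
          naturality f g φ := by
            ext x
            refine (hb _ _ φ.left x g.hom.1 g.hom.2).trans ?_
            have h := CostructuredArrow.w φ
            have h₁ : φ.left ≫ g.hom.1 = f.hom.1 := congr_arg Prod.fst h
            have h₂ : φ.left ≫ g.hom.2 = f.hom.2 := congr_arg Prod.snd h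
            rw [h₁, h₂]
            rfl } }

lemma genDesc_gen {Z : Type u}
    (b : ∀ n : SimplexCategoryᵒᵖ, M.obj n → (n ⟶ j) → (n ⟶ k) → Z)
    (hb : ∀ (n n' : SimplexCategoryᵒᵖ) (θ : n ⟶ n') (x : M.obj n) (α : n' ⟶ j) (β : n' ⟶ k),
      b n' (M.map θ x) α β = b n x (θ ≫ α) (θ ≫ β))
    (x : M.obj n) (α : n ⟶ j) (β : n ⟶ k) : genDesc b hb (gen x α β) = b n x α β :=
  ConcreteCategory.congr_hom
    ((diag.isPointwiseLeftKanExtensionLeftKanExtensionUnit M (j, k)).fac _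
      (CostructuredArrow.mk (Y := n) (Prod.mkHom α β))) x

/-- The element of `diag_!(M)_{j,k}` given by `x : M_j` and its initial vertex. -/
noncomputable def initialGen (k : SimplexCategoryᵒᵖ) (x : M.obj j) :
    (diagShriek.obj M).obj (j, k) :=
  gen x (𝟙 j) (SimplexCategory.const k.unop j.unop 0).op

lemma map_right_initialGen (x : M.obj j) {k' : SimplexCategoryᵒᵖ} (ψ : k ⟶ k') :
    (diagShriek.obj M).map (Prod.mkHom (𝟙 j) ψ) (initialGen k x) = initialGen k' x :=
  map_right_gen _ _ _ _

/-- By `gen_map`, the vertex `0` of `[j]` becomes the vertex `α 0` of `[n]`, the base point of the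
contraction. -/
lemma initialGen_map (x : M.obj n) (α : n ⟶ j) :
    initialGen k (M.map α x) = gen x α (α ≫ (SimplexCategory.const k.unop j.unop 0).op) := by
  rw [initialGen, gen_map, Category.comp_id]

lemma counitToConst_initialGen (x : M.obj j) :
    (counitToConst M).app (j, k) (initialGen k x) = x := by
  rw [initialGen, counitToConst_gen, CategoryTheory.Functor.map_id]
  rfl

end Generators

/-! ### From deformation retractions to weak equivalences -/

/-- If `s` is a section of `r` and `r ≫ s` is connected to the identity by a zigzag of two
homotopies which are constant on `D`, then `s` is an anodyne extension. -/
lemma anodyneExtensions_of_zigzag {D F : SSet.{u}} (s : D ⟶ F) (r : F ⟶ D) (hsr : s ≫ r = 𝟙 D)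
    (h₁ h₂ : F ⊗ Δ[1] ⟶ F) (hs₁ : s ▷ _ ≫ h₁ = fst _ _ ≫ s) (hs₂ : s ▷ _ ≫ h₂ = fst _ _ ≫ s)
    (h₁₁ : cylinderEnd 1 F ≫ h₁ = 𝟙 F) (h₀ : cylinderEnd 0 F ≫ h₁ = cylinderEnd 0 F ≫ h₂)
    (h₂₁ : cylinderEnd 1 F ≫ h₂ = r ≫ s) : anodyneExtensions s := by
  intro X Y p hp
  have : Fibration p := (HomotopicalAlgebra.fibration_iff p).2 hp
  have : IsSplitMono s := ⟨⟨r, hsr⟩⟩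
  refine ⟨fun {a w} sq ↦ ?_⟩
  -- `r ≫ a` lifts `r ≫ s ≫ w`. Transport it back along `h₂`, then forward along `h₁`, to a lift of
  -- `w`; it stays equal to `a` on `D`.
  obtain ⟨G, g₁, g₂, g₃⟩ := exists_homotopy_lift 1 s p (fst _ _ ≫ a) (r ≫ a) (h₂ ≫ w)
    (by rw [reassoc_of% hsr, cylinderEnd_fst_assoc])
    (by rw [reassoc_of% hs₂, Category.assoc, sq.w])
    (by rw [reassoc_of% h₂₁, Category.assoc, sq.w])
  obtain ⟨K, k₁, k₂, k₃⟩ := exists_homotopy_lift 0 s p (fst _ _ ≫ a) (cylinderEnd 0 F ≫ G) (h₁ ≫ w)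
    (by rw [← cylinderEnd_comp_assoc, g₁])
    (by rw [reassoc_of% hs₁, Category.assoc, sq.w])
    (by rw [Category.assoc, g₃, reassoc_of% h₀])
  refine ⟨⟨⟨cylinderEnd 1 F ≫ K, ?_, ?_⟩⟩⟩
  · rw [← cylinderEnd_comp_assoc, k₁, cylinderEnd_fst_assoc]
  · rw [Category.assoc, k₃, reassoc_of% h₁₁]

/-- A retraction whose section is an anodyne extension is a weak equivalence. -/
lemma kanQuillenW_of_anodyne_section {D F : SSet.{u}} (s : D ⟶ F) (r : F ⟶ D)
    (hsr : s ≫ r = 𝟙 D) (hs : anodyneExtensions s) : kanQuillenW r := by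
  let φ := MorphismProperty.factorizationData J.{u}.rlp.llp J.{u}.rlp r
  have : Fibration φ.p := (fibration_iff _).2 φ.hp
  exact ⟨φ.Z, φ.i, φ.p, φ.hi, rlp_I_of_anodyne_section φ.p (s ≫ φ.i)
    (anodyneExtensions.comp_mem _ _ hs φ.hi) (by rw [Category.assoc, φ.fac, hsr]), φ.fac⟩

/-! ### Natural homotopies of simplices -/

/-- A family of monotone maps `(b, t) ↦ e v b t` depending on a base point `v`, natural with
respect to monotone maps. -/
structure PointedHomotopy where
  e (n : ℕ) : Fin (n + 1) → Fin (n + 1) → Fin 2 → Fin (n + 1)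
  mono (n : ℕ) (v : Fin (n + 1)) {b b' : Fin (n + 1)} {t t' : Fin 2} :
    b ≤ b' → t ≤ t' → e n v b t ≤ e n v b' t'
  nat {n n' : ℕ} (θ : Fin (n + 1) →o Fin (n' + 1)) (v b : Fin (n + 1)) (t : Fin 2) :
    θ (e n v b t) = e n' (θ v) (θ b) t

namespace PointedHomotopy

variable (E : PointedHomotopy) {n j k : SimplexCategoryᵒᵖ}

/-- The homotopy from `min v b` to `b`. -/
def minToId : PointedHomotopy where
  e _ v b t := if t = 0 then min v b else b
  mono n v b b' t t' h h' := by
    grind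
  nat θ v b t := by
    split_ifs
    · exact θ.monotone.map_min
    · rfl

/-- The homotopy from `min v b` to `v`. -/
def minToPoint : PointedHomotopy where
  e _ v b t := if t = 0 then min v b else v
  mono n v b b' t t' h h' := by
    grind
  nat θ v b t := by
    split_ifs
    · exact θ.monotone.map_min
    · rfl

/-- Naturality along the map `[0] ⟶ [n]` at `v`, since `[0]` has only one vertex. -/
lemma e_self (n : ℕ) (v : Fin (n + 1)) (t : Fin 2) : E.e n v v t = v :=
  (E.nat (n := 0) (OrderHom.const _ v) 0 0 t).symm

/-- The action on simplices of `Δ[n]`, with base point the image of `0` under `[j] ⟶ [n]`. -/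
def act (α : n ⟶ j) (β : n ⟶ k) (t : (Δ[1] : SSet.{u}).obj k) : n ⟶ k :=
  Quiver.Hom.op (X := k.unop) (Y := n.unop) (SimplexCategory.Hom.mk
    ⟨fun i ↦ E.e _ (α.unop.toOrderHom 0) (β.unop.toOrderHom i) (stdSimplex.asOrderHom t i),
      fun _ _ h ↦ E.mono _ _ (β.unop.toOrderHom.monotone h)
        ((stdSimplex.asOrderHom t).monotone h)⟩)

lemma comp_act {n' : SimplexCategoryᵒᵖ} (θ : n' ⟶ n) (α : n ⟶ j) (β : n ⟶ k)
    (t : (Δ[1] : SSet.{u}).obj k) : θ ≫ E.act α β t = E.act (θ ≫ α) (θ ≫ β) t := by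
  apply Quiver.Hom.unop_inj
  ext i : 3
  exact E.nat θ.unop.toOrderHom _ _ _

lemma act_comp {k' : SimplexCategoryᵒᵖ} (α : n ⟶ j) (β : n ⟶ k) (ψ : k ⟶ k')
    (t : (Δ[1] : SSet.{u}).obj k) :
    E.act α β t ≫ ψ = E.act α (β ≫ ψ) ((Δ[1] : SSet.{u}).map ψ t) := rfl

/-- The action on `diag_!(M)_{j,k}`. -/
noncomputable def actGen (M : SSet.{u}) (t : (Δ[1] : SSet.{u}).obj k) :
    (diagShriek.obj M).obj (j, k) ⟶ (diagShriek.obj M).obj (j, k) :=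
  genDesc (fun _ x α β ↦ gen x α (E.act α β t)) (fun _ _ θ x α β ↦ by rw [gen_map, comp_act])

lemma actGen_gen {M : SSet.{u}} (x : M.obj n) (α : n ⟶ j) (β : n ⟶ k)
    (t : (Δ[1] : SSet.{u}).obj k) : E.actGen M t (gen x α β) = gen x α (E.act α β t) :=
  genDesc_gen _ _ x α β

/-- The induced homotopy of the `j`-th level of `diag_!(M)`. -/
noncomputable def homotopy (j : SimplexCategoryᵒᵖ) (M : SSet.{u}) :
    (level j).obj (diagShriek.obj M) ⊗ Δ[1] ⟶ (level j).obj (diagShriek.obj M) where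
  app k := ↾fun z ↦ E.actGen M z.2 z.1
  naturality k k' ψ := by
    ext ⟨z, t⟩
    obtain ⟨n, x, α, β, rfl⟩ := exists_gen (z : (diagShriek.obj M).obj (j, k))
    change E.actGen M ((Δ[1] : SSet.{u}).map ψ t)
      ((diagShriek.obj M).map (Prod.mkHom (𝟙 j) ψ) (gen x α β)) =
      (diagShriek.obj M).map (Prod.mkHom (𝟙 j) ψ) (E.actGen M t (gen x α β))
    rw [actGen_gen, map_right_gen, map_right_gen, actGen_gen, act_comp]

end PointedHomotopy

/-! ### Deformation of each level onto the initial vertices -/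

section

variable (j : SimplexCategoryᵒᵖ) (M : SSet.{u})

/-- The section of the `j`-th level of the counit selecting the initial vertex. -/
noncomputable def levelSection :
    (level j).obj (const.obj M) ⟶ (level j).obj (diagShriek.obj M) where
  app k := ↾fun (x : M.obj j) ↦ initialGen k x
  naturality k k' ψ := by
    ext x
    refine Eq.trans ?_ (map_right_initialGen (M := M) (j := j) x ψ).symm
    exact congr_arg (initialGen k') (ConcreteCategory.congr_hom (M.map_id j) x)

lemma levelSection_counit : levelSection j M ≫ (level j).map (counitToConst M) = 𝟙 _ := by
  ext k x
  exact counitToConst_initialGen (M := M) (j := j) (k := k) x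

lemma whiskerRight_levelSection_homotopy (E : PointedHomotopy) :
    levelSection j M ▷ _ ≫ E.homotopy j M = fst _ _ ≫ levelSection j M := by
  ext k ⟨x, t⟩
  refine (E.actGen_gen (M := M) (j := j) x (𝟙 j) _ t).trans ?_
  refine congr_arg (gen (M := M) (j := j) x (𝟙 j)) ?_
  apply Quiver.Hom.unop_inj
  ext i : 3
  exact E.e_self _ _ _

lemma cylinderEnd_homotopy_app (ε : Fin 2) (E : PointedHomotopy) {k n : SimplexCategoryᵒᵖ}
    (x : M.obj n) (α : n ⟶ j) (β : n ⟶ k) :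
    (cylinderEnd ε _ ≫ E.homotopy j M).app k (gen x α β) =
      (gen x α (E.act α β (stdSimplex.const.{u} 1 ε k)) :) :=
  E.actGen_gen x α β _

/-- Joins the two homotopies at their common end `min v b`. -/
lemma cylinderEnd_homotopy_congr {ε ε' : Fin 2} {E E' : PointedHomotopy}
    (h : ∀ n v b, E.e n v b ε = E'.e n v b ε') :
    cylinderEnd ε _ ≫ E.homotopy j M = cylinderEnd ε' _ ≫ E'.homotopy j M := by
  ext k z
  obtain ⟨n, x, α, β, rfl⟩ := exists_gen (z : (diagShriek.obj M).obj (j, k))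
  refine (cylinderEnd_homotopy_app j M ε E x α β).trans
    (Eq.trans ?_ (cylinderEnd_homotopy_app j M ε' E' x α β).symm)
  refine congr_arg (gen x α) ?_
  apply Quiver.Hom.unop_inj
  ext i : 3
  exact h _ _ _

lemma cylinderEnd_homotopy_minToId :
    cylinderEnd 1 _ ≫ PointedHomotopy.minToId.homotopy j M = 𝟙 _ := by
  ext k z
  obtain ⟨n, x, α, β, rfl⟩ := exists_gen (z : (diagShriek.obj M).obj (j, k))
  refine (cylinderEnd_homotopy_app j M 1 .minToId x α β).trans (congr_arg (gen x α) ?_)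
  apply Quiver.Hom.unop_inj
  ext i : 3
  rfl

lemma cylinderEnd_homotopy_minToPoint :
    cylinderEnd 1 _ ≫ PointedHomotopy.minToPoint.homotopy j M =
      (level j).map (counitToConst M) ≫ levelSection j M := by
  ext k z
  obtain ⟨n, x, α, β, rfl⟩ := exists_gen (z : (diagShriek.obj M).obj (j, k))
  refine (cylinderEnd_homotopy_app j M 1 .minToPoint x α β).trans ?_
  refine Eq.trans ?_ (congr_arg (initialGen k) (counitToConst_gen x α β)).symm
  rw [initialGen_map]
  rfl

end

/-- The counit `diag_!(M) ⟶ const M` is a levelwise weak equivalence. The argument applies to every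
simplicial set `M`: weak contractibility plays no role. -/
theorem reedyW_counitToConst (M : SSet.{u}) : reedyW (counitToConst M) := fun j ↦
  kanQuillenW_of_anodyne_section (levelSection j M) _ (levelSection_counit j M)
    (anodyneExtensions_of_zigzag _ _ (levelSection_counit j M)
      (PointedHomotopy.minToId.homotopy j M) (PointedHomotopy.minToPoint.homotopy j M)
      (whiskerRight_levelSection_homotopy j M _) (whiskerRight_levelSection_homotopy j M _)
      (cylinderEnd_homotopy_minToId j M) (cylinderEnd_homotopy_congr j M fun _ _ _ ↦ rfl)
      (cylinderEnd_homotopy_minToPoint j M))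

end BisimplicialSets

theorem mainTheorem12 (M : SSet.{u}) (hM : BisimplicialSets.IsAcyclic M) :
    BisimplicialSets.reedyW (BisimplicialSets.counitToConst M) :=
  BisimplicialSets.reedyW_counitToConst M
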